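/- Let $X_1, X_2, X_3, \dots$ be an exchangeable sequence of real-valued random variables, i.e. for every $N$ and every permutation $\tau$ of $\{1,\dots,N\}$ the vectors $(X_{\tau(1)},\dots,X_{\tau(N)})$ and $(X_1,\dots,X_N)$ have the same distribution. Suppose that $\mathbb{E}[X_1]=0$, $\mathbb{E}[X_1X_2]=0$ and $\mathbb{E}[|X_1|^4]<\infty$. Let $\mathfrak{F}$ be the set of one-dimensional distribution functions, with the $\sigma$-field generated by the sets $\{F\in\mathfrak{F} \mid F(x)\le y\}$ $(x,y\in\mathbb{R})$. For $F\in\mathfrak{F}$ let $X_F,X_{F,1},X_{F,2},\dots$ be i.i.d. random variables with distribution function $F$. Put $\mathfrak{F}_0=\{F\in\mathfrak{F} \mid \mathbb{E}|X_F|<\infty,\ \mathbb{E}[X_F]=0\}$ and $\mathfrak{F}_0'=\{F\in\mathfrak{F}_0 \mid \mathbb{E}[|X_F|^2]<\infty\}$. Then there is a probability measure $\mu_X$ on $\mathfrak{F}$ (a directing measure of the sequence) such that $$\mathbb{P}((X_1,\dots,X_n)\in B)=\int_{\mathfrak{F}}\mathbb{P}((X_{F,1},\dots,X_{F,n})\in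 B)\,d\mu_X(F)\qquad\text{for all } n \text{ and all Borel sets } B\subset\mathbb{R}^n,$$ and for every such $\mu_X$ the following are equivalent, where $Z_X$ denotes a random variable whose law is the centered Gaussian mixture $\int_{\mathfrak{F}_0'} N(0,\mathbb{E}[|X_F|^2])\,d\mu_X(F)$. 1. $\mathrm{Cov}(X_1^2,X_2^2)=0$. 2. $\mu_X(\{F\in\mathfrak{F}_0 \mid \mathbb{E}[|X_F|^2]=\mathbb{E}[|X_1|^2]\})=1$. 3. $Z_X$ is normally distributed, i.e. its law is $N(m,v)$ for some $m\in\mathbb{R}$ and $v\ge 0$. Here $N(m,0)$ denotes the point mass at $m$. -/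

import Mathlib

open MeasureTheory ProbabilityTheory Filter Topology
open scoped ENNReal NNReal

/-- A sequence `X 0, X 1, …` of real random variables is exchangeable if for every `N` and every
permutation `τ` of the first `N` indices, `(X (τ 0), …, X (τ (N-1)))` and `(X 0, …, X (N-1))` have
the same joint distribution. -/
def Exchangeable {Ω : Type*} [MeasurableSpace Ω] (P : Measure Ω) (X : ℕ → Ω → ℝ) : Prop :=
  ∀ (N : ℕ) (τ : Equiv.Perm (Fin N)),
    P.map (fun ω (i : Fin N) => X (τ i) ω) = P.map (fun ω (i : Fin N) => X i ω)

/-- One-dimensional distribution functions: right-continuous monotone functions `ℝ → ℝ` with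
limit `0` at `-∞` and limit `1` at `+∞` (so that all values lie in `[0,1]`). -/
structure DistFun where
  toFun : StieltjesFunction ℝ
  tendsto_atBot : Tendsto (fun x => toFun x) atBot (𝓝 0)
  tendsto_atTop : Tendsto (fun x => toFun x) atTop (𝓝 1)

namespace DistFun

/-- The σ-field on the set of distribution functions generated by the sets `{F | F x ≤ y}`. -/
instance : MeasurableSpace DistFun :=
  MeasurableSpace.generateFrom {A | ∃ x y : ℝ, A = {F : DistFun | F.toFun x ≤ y}}

/-- The probability distribution on `ℝ` with distribution function `F`: the law of `X_F`. -/
noncomputable def law (F : DistFun) : Measure ℝ := F.toFun.measure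

instance (F : DistFun) : IsProbabilityMeasure F.law :=
  F.toFun.isProbabilityMeasure F.tendsto_atBot F.tendsto_atTop

theorem law_Iic (F : DistFun) (x : ℝ) : F.law (Set.Iic x) = ENNReal.ofReal (F.toFun x) := by
  rw [law, F.toFun.measure_Iic F.tendsto_atBot, sub_zero]

theorem measurable_law : Measurable law := by
  refine Measurable.measure_of_isPiSystem_of_isProbabilityMeasure
    (borel_eq_generateFrom_Iic ℝ ▸ BorelSpace.measurable_eq) isPiSystem_Iic ?_
  rintro _ ⟨x, rfl⟩
  simp only [law_Iic]
  refine ENNReal.measurable_ofReal.comp (measurable_of_Iic fun y => ?_)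
  exact MeasurableSpace.measurableSet_generateFrom ⟨x, y, rfl⟩

/-- The second moment `E[|X_F|^2] ∈ [0, ∞]`. -/
noncomputable def secondMoment (F : DistFun) : ℝ≥0∞ := ∫⁻ x, ENNReal.ofReal (x ^ 2) ∂F.law

theorem measurable_secondMoment : Measurable secondMoment :=
  (Measure.measurable_lintegral (by fun_prop)).comp measurable_law

/-- `X_F` has an expectation and `E[X_F] = 0`. -/
def Centered (F : DistFun) : Prop := Integrable (fun x : ℝ => x) F.law ∧ ∫ x, x ∂F.law = 0

end DistFun

/-- `μX` is a directing (de Finetti) measure of the sequence `X`: a probability measure on the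
space of distribution functions such that, for all `n` and all Borel sets `B ⊆ ℝⁿ`,
`P((X 0, …, X (n-1)) ∈ B) = ∫ P((X_{F,1}, …, X_{F,n}) ∈ B) dμX(F)`, where the `X_{F,i}` are
i.i.d. with distribution function `F`. -/
structure IsDirectingMeasure {Ω : Type*} [MeasurableSpace Ω] (P : Measure Ω) (X : ℕ → Ω → ℝ)
    (μX : Measure DistFun) : Prop where
  isProbabilityMeasure : IsProbabilityMeasure μX
  prob_eq : ∀ (n : ℕ) (B : Set (Fin n → ℝ)), MeasurableSet B →
    P {ω | (fun i : Fin n => X i ω) ∈ B} = ∫⁻ F, Measure.pi (fun _ : Fin n => F.law) B ∂μX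

/-- The centered Gaussian mixture directed by `μX`, that is, the law of `Z_X`:
`∫ N(0, E[|X_F|^2]) dμX(F)` over all `F` with `E[X_F] = 0` and `E[|X_F|^2] < ∞`. The normal law
`N(0, 0)` is the point mass at `0`; if `E[|X_F|^2] > 0` for almost all these `F`, this is the
measure with density `x ↦ ∫ (2π E[|X_F|^2])^(-1/2) exp (-x^2 / (2 E[|X_F|^2])) dμX(F)`. -/
noncomputable def gaussianMixture (μX : Measure DistFun) : Measure ℝ :=
  (μX.restrict {F | F.Centered ∧ F.secondMoment < ∞}).bind
    (fun F => gaussianReal 0 F.secondMoment.toNNReal)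

/-!
Existence of a directing measure is de Finetti's theorem. Let `Y = (X 1, X 3, X 5, …)` and let `κ` be
the conditional distribution of `X 0` given `(X 1, X 2, …)`. Exchangeability makes the law of
`X ∘ σ` the same for all injective `σ`, so that `κ (X ∘ σ)` is the conditional distribution of `X k`
given `X ∘ σ` whenever `k ∉ range σ`. If the range of `σ` contains the odd numbers, then `κ Y A` and
`κ (X ∘ σ) A` are conditional expectations of the same variable given two nested σ-fields, and they
have the same law, hence the same `L²` norm; therefore they coincide
(`Exchangeable.condDistribHead_ae_eq`). In other words, given `Y`, further variables do not help to
predict `X k`: conditionally on `Y` the variables `X 0, X 2, X 4, …` are i.i.d. with law `κ Y`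
(`Exchangeable.lintegral_prod_indicator`), and the law of `κ Y` is a directing measure.

For the equivalences, write `s F` for the second moment and `m F` for the mean of `F`. Integrating
over the directing measure, `E[X 0 * X 1]` is the mean of `(m F)²`, so almost every `F` is centered;
and `Cov(X 0 ^ 2, X 1 ^ 2)` is the variance of `s F`, which vanishes iff `s F` is almost surely equal
to its mean `E[X 0 ^ 2]`. In that case the mixture is a single Gaussian law. Conversely, the modulus
of the characteristic function of the mixture at `t` is the mean of `exp (-s F * t² / 2)`; if the
mixture is `N(m, v)`, this is `exp (-v * t² / 2)`, so `exp (-s F)` has mean `exp (-v)` and second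
moment `exp (-v)²`, and `s F = v` almost surely.

The equality case of the inequality `2 * f * g ≤ f² + g²`
(`ae_eq_of_lintegral_sq_add_lintegral_sq_eq`) carries each of these almost sure equalities.
-/

/-! ### Equality in the mean square -/

theorem ae_ne_top_of_lintegral_mul_self_ne_top {α : Type*} [MeasurableSpace α]
    {μ : Measure α} {f : α → ℝ≥0∞} (hf : Measurable f) (hf2 : ∫⁻ a, f a * f a ∂μ ≠ ∞) :
    ∀ᵐ a ∂μ, f a ≠ ∞ := by
  filter_upwards [ae_lt_top (hf.mul hf) hf2] with a ha hau
  simp [hau] at ha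

/-- If `f` and `g` have finite second moments and `∫ f² + ∫ g² = 2 ∫ f g`, that is, `∫ (f - g)² = 0`
stated without subtraction, then `f = g` almost everywhere. -/
theorem ae_eq_of_lintegral_sq_add_lintegral_sq_eq {α : Type*} [MeasurableSpace α]
    {μ : Measure α} {f g : α → ℝ≥0∞} (hf : Measurable f) (hg : Measurable g)
    (hf2 : ∫⁻ a, f a * f a ∂μ ≠ ∞) (hg2 : ∫⁻ a, g a * g a ∂μ ≠ ∞)
    (h : ∫⁻ a, f a * f a ∂μ + ∫⁻ a, g a * g a ∂μ = 2 * ∫⁻ a, f a * g a ∂μ) : f =ᵐ[μ] g := by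
  have key : ∀ x y : ℝ≥0∞, x ≠ ∞ → y ≠ ∞ →
      2 * (x * y) ≤ x * x + y * y ∧ (2 * (x * y) = x * x + y * y → x = y) := by
    intro x y hx hy
    lift x to ℝ≥0 using hx
    lift y to ℝ≥0 using hy
    norm_cast
    refine ⟨?_, fun h => ?_⟩
    · rw [← NNReal.coe_le_coe]
      push_cast
      nlinarith [sq_nonneg ((x : ℝ) - y)]
    · have h' : 2 * ((x : ℝ) * y) = x * x + y * y := by exact_mod_cast h
      have : ((x : ℝ) - y) ^ 2 = 0 := by nlinarith
      exact NNReal.eq (sub_eq_zero.1 (pow_eq_zero_iff (two_ne_zero) |>.1 this))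
  have hf' := ae_ne_top_of_lintegral_mul_self_ne_top hf hf2
  have hg' := ae_ne_top_of_lintegral_mul_self_ne_top hg hg2
  have hle : (fun a => 2 * (f a * g a)) ≤ᵐ[μ] fun a => f a * f a + g a * g a := by
    filter_upwards [hf', hg'] with a h1 h2 using (key _ _ h1 h2).1
  have hI : ∫⁻ a, 2 * (f a * g a) ∂μ = ∫⁻ a, f a * f a + g a * g a ∂μ := by
    rw [lintegral_const_mul _ (by fun_prop), ← h, lintegral_add_left (by fun_prop)]
  have := ae_eq_of_ae_le_of_lintegral_le hle
    (by rw [hI, lintegral_add_left (by fun_prop)]; exact ENNReal.add_ne_top.2 ⟨hf2, hg2⟩)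
    ((hf.mul hf).add (hg.mul hg)).aemeasurable hI.ge
  filter_upwards [this, hf', hg'] with a ha h1 h2 using (key _ _ h1 h2).2 ha

/-- A random variable with vanishing variance is almost surely constant. -/
theorem ae_eq_const_of_lintegral_sq_eq {α : Type*} [MeasurableSpace α] {μ : Measure α}
    [IsProbabilityMeasure μ] {f : α → ℝ≥0∞} (hf : Measurable f) {c : ℝ≥0∞} (hc : c ≠ ∞)
    (h1 : ∫⁻ a, f a ∂μ = c) (h2 : ∫⁻ a, f a * f a ∂μ = c * c) : ∀ᵐ a ∂μ, f a = c := by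
  refine ae_eq_of_lintegral_sq_add_lintegral_sq_eq (g := fun _ => c) hf measurable_const
    (h2 ▸ ENNReal.mul_ne_top hc hc) (by simpa using ENNReal.mul_ne_top hc hc) ?_
  rw [lintegral_mul_const _ hf, h1, h2]
  simp [two_mul]

/-! ### De Finetti's theorem -/

/-- Exchangeability concerns permutations of finitely many indices only, but determines the law of
every subsequence: an injection restricted to a finite set extends to a permutation of some
`Fin N`. -/
theorem Exchangeable.map_comp_injective {Ω : Type*} [MeasurableSpace Ω] {P : Measure Ω}
    [IsProbabilityMeasure P] {X : ℕ → Ω → ℝ} (hX : ∀ i, Measurable (X i))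
    (hexch : Exchangeable P X) {σ : ℕ → ℕ} (hσ : σ.Injective) :
    P.map (fun ω i => X (σ i) ω) = P.map (fun ω i => X i ω) := by
  refine (map_eq_iff_forall_finset_map_restrict_eq (X := fun i => X (σ i)) (Y := X)
    (by fun_prop) (by fun_prop)).2 fun I => ?_
  obtain ⟨N, hN⟩ : ∃ N, ∀ i ∈ I, i < N ∧ σ i < N := by
    refine ⟨I.sup id + I.sup σ + 1, fun i hi => ?_⟩
    have h1 : id i ≤ I.sup id := Finset.le_sup hi
    have h2 : σ i ≤ I.sup σ := Finset.le_sup hi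
    simp only [id] at h1
    omega
  obtain ⟨τ, hτ⟩ := Equiv.Perm.exists_extending_pair (α := I) (β := Fin N)
    (fun i => ⟨i, (hN i i.2).1⟩) (fun i => ⟨σ i, (hN i i.2).2⟩)
    (fun i j h => Subtype.ext (by simpa using h))
    (fun i j h => Subtype.ext (hσ (by simpa using h)))
  have h := congrArg (Measure.map fun (x : Fin N → ℝ) (i : I) => x ⟨i, (hN i i.2).1⟩) (hexch N τ)
  rw [Measure.map_map (by fun_prop) (by fun_prop), Measure.map_map (by fun_prop) (by fun_prop)] at h
  convert h using 2
  · ext ω i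
    simp [hτ]
  · rfl

/-- The conditional distribution of the first variable of a sequence given all later ones. -/
noncomputable def condDistribHead {Ω : Type*} [MeasurableSpace Ω] (P : Measure Ω)
    [IsFiniteMeasure P] (X : ℕ → Ω → ℝ) : Kernel (ℕ → ℝ) ℝ :=
  condDistrib (X 0) (fun ω i => X (i + 1) ω) P

instance {Ω : Type*} [MeasurableSpace Ω] (P : Measure Ω)
    [IsFiniteMeasure P] (X : ℕ → Ω → ℝ) : IsMarkovKernel (condDistribHead P X) := by
  unfold condDistribHead; infer_instance

section DeFinetti
variable {Ω : Type*} [MeasurableSpace Ω] {P : Measure Ω}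
    [IsProbabilityMeasure P] {X : ℕ → Ω → ℝ}

/-- `condDistribHead P X (X ∘ σ)` is the conditional distribution of `X k` given `X ∘ σ`, for every
injective `σ` which omits the value `k`. -/
theorem Exchangeable.lintegral_indicator_mul (hX : ∀ i, Measurable (X i))
    (hexch : Exchangeable P X) {σ : ℕ → ℕ} (hσ : σ.Injective) {k : ℕ} (hk : k ∉ Set.range σ)
    {A : Set ℝ} (hA : MeasurableSet A) {φ : (ℕ → ℝ) → ℝ≥0∞} (hφ : Measurable φ) :
    ∫⁻ ω, A.indicator 1 (X k ω) * φ (fun i => X (σ i) ω) ∂P =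
      ∫⁻ ω, condDistribHead P X (fun i => X (σ i) ω) A * φ (fun i => X (σ i) ω) ∂P := by
  -- The identity for `k = 0`, `σ = succ` is the defining property of the conditional distribution.
  have hψ := (condDistribHead P X).measurable_coe hA
  have hhead : ∫⁻ ω, A.indicator 1 (X 0 ω) * φ (fun i => X (i + 1) ω) ∂P =
      ∫⁻ ω, condDistribHead P X (fun i => X (i + 1) ω) A * φ (fun i => X (i + 1) ω) ∂P := by
    have h := compProd_map_condDistrib (μ := P) (X := fun ω (i : ℕ) => X (i + 1) ω)
      (mβ := MeasurableSpace.pi)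
      (Y := X 0) (hX 0).aemeasurable
    have hm : Measurable fun p : (ℕ → ℝ) × ℝ => A.indicator (1 : ℝ → ℝ≥0∞) p.2 * φ p.1 :=
      ((measurable_one.indicator hA).comp measurable_snd).mul (hφ.comp measurable_fst)
    have h' := congrArg (fun μ => ∫⁻ p : (ℕ → ℝ) × ℝ, A.indicator (1 : ℝ → ℝ≥0∞) p.2 * φ p.1 ∂μ) h
    rw [Measure.lintegral_compProd hm, lintegral_map hm (by fun_prop),
      lintegral_map (Measurable.lintegral_kernel_prod_right' hm) (by fun_prop)] at h'
    rw [← h']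
    refine lintegral_congr fun ω => ?_
    dsimp only
    rw [lintegral_mul_const _ (measurable_one.indicator hA), lintegral_indicator_one hA]
    rfl
  -- Both sides are functionals of the joint law of `X k` and the `X (σ i)`.
  let σ' : ℕ → ℕ := fun n => Nat.casesOn n k σ
  have hσ' : σ'.Injective := by
    rintro (_ | i) (_ | j) h
    · rfl
    · exact absurd ⟨j, h.symm⟩ hk
    · exact absurd ⟨i, h⟩ hk
    · exact congrArg _ (hσ h)
  have hlaw := hexch.map_comp_injective hX hσ'
  have transfer : ∀ {f : (ℕ → ℝ) → ℝ≥0∞}, Measurable f →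
      ∫⁻ ω, f (fun i => X (σ' i) ω) ∂P = ∫⁻ ω, f (fun i => X i ω) ∂P := by
    intro f hf
    rw [← lintegral_map (f := f) (g := fun ω i => X (σ' i) ω) hf (by fun_prop), hlaw,
      lintegral_map hf (by fun_prop)]
  have h0 : Measurable fun x : ℕ → ℝ => A.indicator (1 : ℝ → ℝ≥0∞) (x 0) :=
    (measurable_one.indicator hA).comp (measurable_pi_apply 0)
  have hs : Measurable fun (x : ℕ → ℝ) (i : ℕ) => x (i + 1) := by fun_prop
  have h1 := transfer (h0.mul (hφ.comp hs))
  have h2 := transfer ((hψ.comp hs).mul (hφ.comp hs))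
  simp only [Pi.mul_apply, Function.comp_def] at h1 h2
  exact h1.trans (hhead.trans h2.symm)

/-- The conditional distribution of `X k` given `X ∘ σ` is the one given the subsequence
`X ∘ σ ∘ ρ`. Projecting the indicator of `X k ∈ A` to the larger and to the smaller σ-field gives
random variables with equal laws, hence equal `L²` norms, and so the two projections coincide. -/
theorem Exchangeable.condDistribHead_ae_eq (hX : ∀ i, Measurable (X i))
    (hexch : Exchangeable P X) {σ ρ : ℕ → ℕ} (hσ : σ.Injective) (hρ : ρ.Injective)
    {k : ℕ} (hk : k ∉ Set.range σ) {A : Set ℝ} (hA : MeasurableSet A) :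
    (fun ω => condDistribHead P X (fun i => X (σ i) ω) A) =ᵐ[P]
      fun ω => condDistribHead P X (fun i => X (σ (ρ i)) ω) A := by
  have hψ := (condDistribHead P X).measurable_coe hA
  have hfin : ∀ τ : ℕ → ℕ, ∫⁻ ω, condDistribHead P X (fun i => X (τ i) ω) A *
      condDistribHead P X (fun i => X (τ i) ω) A ∂P ≠ ∞ := by
    intro τ
    refine ((lintegral_mono fun ω => mul_le_one' prob_le_one prob_le_one).trans_lt ?_).ne
    simp
  have hlaw : ∫⁻ ω, condDistribHead P X (fun i => X (σ i) ω) A *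
      condDistribHead P X (fun i => X (σ i) ω) A ∂P =
      ∫⁻ ω, condDistribHead P X (fun i => X (σ (ρ i)) ω) A *
      condDistribHead P X (fun i => X (σ (ρ i)) ω) A ∂P := by
    rw [← lintegral_map (f := fun y => condDistribHead P X y A * condDistribHead P X y A)
        (g := fun ω i => X (σ i) ω) (hψ.mul hψ) (by fun_prop),
      ← lintegral_map (f := fun y => condDistribHead P X y A * condDistribHead P X y A)
        (g := fun ω i => X (σ (ρ i)) ω) (hψ.mul hψ) (by fun_prop),
      hexch.map_comp_injective hX hσ,
      hexch.map_comp_injective hX (σ := fun i => σ (ρ i)) (hσ.comp hρ)]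
  have hsub : Measurable fun (x : ℕ → ℝ) (i : ℕ) => x (ρ i) := by fun_prop
  refine ae_eq_of_lintegral_sq_add_lintegral_sq_eq (hψ.comp (by fun_prop))
    (hψ.comp (by fun_prop)) (hfin σ) (hfin fun i => σ (ρ i)) ?_
  -- As `X ∘ σ ∘ ρ` is a function of `X ∘ σ`, the projection to its σ-field has the same inner product
  -- with the indicator as with the other projection.
  have h1 := hexch.lintegral_indicator_mul hX hσ hk hA (hψ.comp hsub)
  have h2 := hexch.lintegral_indicator_mul hX (hσ.comp hρ)
    (k := k) (fun ⟨i, hi⟩ => hk ⟨ρ i, hi⟩) hA hψ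
  simp only [Function.comp_def] at h1 h2
  rw [hlaw, ← h1, h2, two_mul]

/-- Conditionally on the variables with odd indices, those with even indices are independent and
identically distributed. -/
theorem Exchangeable.lintegral_prod_indicator (hX : ∀ i, Measurable (X i))
    (hexch : Exchangeable P X) (A : ℕ → Set ℝ) (hA : ∀ j, MeasurableSet (A j)) (n : ℕ)
    {φ : (ℕ → ℝ) → ℝ≥0∞} (hφ : Measurable φ) :
    ∫⁻ ω, (∏ j ∈ Finset.range n, (A j).indicator 1 (X (2 * j) ω)) *
        φ (fun i => X (2 * i + 1) ω) ∂P =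
      ∫⁻ ω, (∏ j ∈ Finset.range n, condDistribHead P X (fun i => X (2 * i + 1) ω) (A j)) *
        φ (fun i => X (2 * i + 1) ω) ∂P := by
  induction n generalizing φ with
  | zero => simp
  | succ n ih =>
    have hψ := (condDistribHead P X).measurable_coe (hA n)
    -- `σ` enumerates all indices but `2 * n`, and `σ ∘ ρ` the odd ones.
    let σ : ℕ → ℕ := fun i => if i < 2 * n then i else i + 1
    let ρ : ℕ → ℕ := fun i => if i < n then 2 * i + 1 else 2 * i
    have hσ : σ.Injective := by intro i j; simp only [σ]; grind
    have hρ : ρ.Injective := by intro i j; simp only [ρ]; grind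
    have hσρ : ∀ i, σ (ρ i) = 2 * i + 1 := by intro i; simp only [σ, ρ]; grind
    have hσe : ∀ j ∈ Finset.range n, σ (2 * j) = 2 * j := by
      intro j hj
      have := Finset.mem_range.1 hj
      simp only [σ]; grind
    have hk : 2 * n ∉ Set.range σ := by
      rintro ⟨i, hi⟩
      simp only [σ] at hi; grind
    have hind : ∀ j, Measurable ((A j).indicator (1 : ℝ → ℝ≥0∞)) := fun j =>
      measurable_one.indicator (hA j)
    have hΦ : Measurable fun x : ℕ → ℝ =>
        (∏ j ∈ Finset.range n, (A j).indicator (1 : ℝ → ℝ≥0∞) (x (2 * j))) *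
          φ (fun i => x (ρ i)) :=
      (Finset.measurable_fun_prod _ fun j _ => (hind j).comp (measurable_pi_apply _)).mul
        (hφ.comp (by fun_prop))
    have h := hexch.lintegral_indicator_mul hX hσ hk (hA n) hΦ
    have hae := hexch.condDistribHead_ae_eq hX hσ hρ hk (hA n)
    have hpr : ∀ ω, ∏ j ∈ Finset.range n, (A j).indicator (1 : ℝ → ℝ≥0∞) (X (σ (2 * j)) ω) =
        ∏ j ∈ Finset.range n, (A j).indicator (1 : ℝ → ℝ≥0∞) (X (2 * j) ω) := fun ω =>
      Finset.prod_congr rfl fun j hj => by rw [hσe j hj]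
    simp only [hσρ, hpr] at h hae
    simp only [Finset.prod_range_succ]
    -- Integrate out `X (2 * n)` given all other variables, then discard all but the odd ones.
    calc
      _ = ∫⁻ ω, (A n).indicator 1 (X (2 * n) ω) *
          ((∏ j ∈ Finset.range n, (A j).indicator 1 (X (2 * j) ω)) *
            φ (fun i => X (2 * i + 1) ω)) ∂P := lintegral_congr fun ω => by ring
      _ = _ := h
      _ = ∫⁻ ω, (∏ j ∈ Finset.range n, (A j).indicator 1 (X (2 * j) ω)) *
          (condDistribHead P X (fun i => X (2 * i + 1) ω) (A n) *
            φ (fun i => X (2 * i + 1) ω)) ∂P := by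
        refine lintegral_congr_ae ?_
        filter_upwards [hae] with ω hω
        rw [hω]; ring
      _ = _ := ih (φ := fun y => condDistribHead P X y (A n) * φ y) (hψ.mul hφ)
      _ = _ := lintegral_congr fun ω => by ring
end DeFinetti

namespace DistFun

/-- The distribution function of a probability measure on `ℝ`. -/
noncomputable def ofMeasure (ν : Measure ℝ) : DistFun where
  toFun := cdf ν
  tendsto_atBot := tendsto_cdf_atBot ν
  tendsto_atTop := tendsto_cdf_atTop ν

theorem law_ofMeasure (ν : Measure ℝ) [IsProbabilityMeasure ν] : (ofMeasure ν).law = ν :=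
  measure_cdf ν

theorem measurable_ofMeasure_kernel {α : Type*} [MeasurableSpace α] (κ : Kernel α ℝ)
    [IsMarkovKernel κ] : Measurable fun a => ofMeasure (κ a) := by
  refine measurable_generateFrom ?_
  rintro _ ⟨x, y, rfl⟩
  refine measurableSet_le (f := fun a => cdf (κ a) x) ?_ measurable_const
  simp only [cdf_eq_real, measureReal_def]
  exact (κ.measurable_coe measurableSet_Iic).ennreal_toReal

theorem measurable_pi_law (n : ℕ) :
    Measurable fun F : DistFun => Measure.pi (fun _ : Fin n => F.law) := by
  refine Measurable.measure_of_isPiSystem_of_isProbabilityMeasure generateFrom_pi.symm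
    isPiSystem_pi ?_
  rintro _ ⟨A, hA, rfl⟩
  simp only [Measure.pi_pi]
  have hA : ∀ i, MeasurableSet (A i) := fun i => hA i trivial
  exact Finset.measurable_fun_prod _ fun i _ =>
    (Measure.measurable_coe (hA i)).comp measurable_law

end DistFun

/-- **De Finetti's theorem** for real random variables. -/
theorem Exchangeable.exists_isDirectingMeasure {Ω : Type*} [MeasurableSpace Ω] {P : Measure Ω}
    [IsProbabilityMeasure P] {X : ℕ → Ω → ℝ} (hX : ∀ i, Measurable (X i))
    (hexch : Exchangeable P X) : ∃ μX : Measure DistFun, IsDirectingMeasure P X μX := by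
  let Y : Ω → DistFun := fun ω => .ofMeasure (condDistribHead P X fun i => X (2 * i + 1) ω)
  have hY : Measurable Y :=
    (DistFun.measurable_ofMeasure_kernel (condDistribHead P X)).comp (by fun_prop)
  have hprob : IsProbabilityMeasure (P.map Y) := Measure.isProbabilityMeasure_map hY.aemeasurable
  refine ⟨P.map Y, hprob, fun n B hB => ?_⟩
  have hm := DistFun.measurable_pi_law n
  have heq : P.map (fun ω (i : Fin n) => X i ω) =
      (P.map Y).bind fun F => Measure.pi fun _ : Fin n => F.law := by
    have : IsProbabilityMeasure ((P.map Y).bind fun F => Measure.pi fun _ : Fin n => F.law) :=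
      isProbabilityMeasure_bind hm.aemeasurable (ae_of_all _ fun _ => inferInstance)
    have : IsProbabilityMeasure (P.map fun ω (i : Fin n) => X i ω) :=
      Measure.isProbabilityMeasure_map (by fun_prop)
    refine ext_of_generate_finite _ generateFrom_pi.symm isPiSystem_pi ?_ (by simp)
    rintro _ ⟨A, hA, rfl⟩
    have hA : ∀ i, MeasurableSet (A i) := fun i => hA i trivial
    have hAm : MeasurableSet (Set.univ.pi A) := .univ_pi hA
    rw [Measure.bind_apply hAm hm.aemeasurable,
      lintegral_map (f := fun F : DistFun => Measure.pi (fun _ : Fin n => F.law) (Set.univ.pi A))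
        ((Measure.measurable_coe hAm).comp hm) hY]
    simp only [Y, DistFun.law_ofMeasure, Measure.pi_pi]
    -- Exchangeability allows replacing the first `n` variables by the first `n` even ones.
    have hlaw := congrArg (Measure.map fun (x : ℕ → ℝ) (i : Fin n) => x i)
      (hexch.map_comp_injective hX (σ := fun i => 2 * i) (mul_right_injective₀ two_ne_zero))
    rw [Measure.map_map (by fun_prop) (by fun_prop),
      Measure.map_map (by fun_prop) (by fun_prop)] at hlaw
    change P.map (fun ω (i : Fin n) => X (2 * i) ω) = P.map (fun ω (i : Fin n) => X i ω) at hlaw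
    rw [← hlaw, Measure.map_apply (by fun_prop) hAm]
    have h := hexch.lintegral_prod_indicator hX (fun j => if h : j < n then A ⟨j, h⟩ else Set.univ)
      (fun j => by split_ifs <;> simp [hA]) n (φ := 1) measurable_one
    simp only [Finset.prod_range, Pi.one_apply, mul_one, Fin.is_lt, dite_true] at h
    rw [← h, ← lintegral_indicator_one (hAm.preimage (by fun_prop))]
    refine lintegral_congr fun ω => ?_
    by_cases hω : ∀ i : Fin n, X (2 * i) ω ∈ A i
    · simp [Set.indicator, hω]
    · obtain ⟨i, hi⟩ := not_forall.1 hω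
      rw [Finset.prod_eq_zero (Finset.mem_univ i) (by simp [hi])]
      simp [Set.indicator, hω]
  rw [← Measure.bind_apply hB hm.aemeasurable, ← heq, Measure.map_apply (by fun_prop) hB]
  rfl

/-! ### Moments under a directing measure -/

theorem ENNReal.ofReal_mul_eq_add (x y : ℝ) : ENNReal.ofReal (x * y) =
    ENNReal.ofReal x * ENNReal.ofReal y + ENNReal.ofReal (-x) * ENNReal.ofReal (-y) := by
  rcases le_total 0 x with hx | hx
  · rw [ENNReal.ofReal_mul hx, ENNReal.ofReal_of_nonpos (neg_nonpos.2 hx), zero_mul, add_zero]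
  · rw [← neg_mul_neg, ENNReal.ofReal_mul (neg_nonneg.2 hx), ENNReal.ofReal_of_nonpos hx, zero_mul,
      zero_add]

theorem lintegral_ofReal_eq_of_integral_eq_zero {α : Type*} [MeasurableSpace α] {μ : Measure α}
    {f : α → ℝ} (hf : Integrable f μ) (h : ∫ a, f a ∂μ = 0) :
    ∫⁻ a, ENNReal.ofReal (f a) ∂μ = ∫⁻ a, ENNReal.ofReal (-f a) ∂μ := by
  rw [integral_eq_lintegral_pos_part_sub_lintegral_neg_part hf, sub_eq_zero] at h
  exact (ENNReal.toReal_eq_toReal_iff' hf.lintegral_lt_top.ne hf.neg.lintegral_lt_top.ne).1 h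

namespace IsDirectingMeasure
variable {Ω : Type*} [MeasurableSpace Ω] {P : Measure Ω} {X : ℕ → Ω → ℝ} {μX : Measure DistFun}

theorem lintegral_eq (h : IsDirectingMeasure P X μX) (hX : ∀ i, Measurable (X i)) {n : ℕ}
    {f : (Fin n → ℝ) → ℝ≥0∞} (hf : Measurable f) :
    ∫⁻ ω, f (fun i => X i ω) ∂P = ∫⁻ F, ∫⁻ x, f x ∂Measure.pi (fun _ : Fin n => F.law) ∂μX := by
  have hm := DistFun.measurable_pi_law n
  have hlaw : P.map (fun ω (i : Fin n) => X i ω) =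
      μX.bind fun F => Measure.pi fun _ : Fin n => F.law := by
    ext B hB
    rw [Measure.map_apply (by fun_prop) hB, Measure.bind_apply hB hm.aemeasurable,
      ← h.prob_eq n B hB]
    rfl
  rw [← Measure.lintegral_bind hm.aemeasurable hf.aemeasurable, ← hlaw,
    lintegral_map hf (by fun_prop)]

theorem lintegral_mul (h : IsDirectingMeasure P X μX) (hX : ∀ i, Measurable (X i))
    {f g : ℝ → ℝ≥0∞} (hf : Measurable f) (hg : Measurable g) :
    ∫⁻ ω, f (X 0 ω) * g (X 1 ω) ∂P =
      ∫⁻ F, (∫⁻ x, f x ∂F.law) * ∫⁻ x, g x ∂F.law ∂μX := by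
  have hm : Measurable fun p : ℝ × ℝ => f p.1 * g p.2 :=
    (hf.comp measurable_fst).mul (hg.comp measurable_snd)
  refine (h.lintegral_eq hX (n := 2) (f := fun x => f (x 0) * g (x 1))
    ((hf.comp (measurable_pi_apply 0)).mul (hg.comp (measurable_pi_apply 1)))).trans ?_
  refine lintegral_congr fun F => ?_
  rw [← lintegral_prod_mul hf.aemeasurable hg.aemeasurable,
    ← (measurePreserving_finTwoArrow F.law).lintegral_comp hm]
  rfl

theorem lintegral_head (h : IsDirectingMeasure P X μX) (hX : ∀ i, Measurable (X i))
    {f : ℝ → ℝ≥0∞} (hf : Measurable f) :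
    ∫⁻ ω, f (X 0 ω) ∂P = ∫⁻ F, ∫⁻ x, f x ∂F.law ∂μX := by
  simpa using h.lintegral_mul hX hf (g := 1) measurable_one

/-- If `E[X 0 * X 1] = 0`, the directing measure is concentrated on centered distributions: the
expectation is the integral of the square of the mean of `F`, written here in terms of positive and
negative parts. -/
theorem ae_centered (h : IsDirectingMeasure P X μX) (hX : ∀ i, Measurable (X i))
    (hint : Integrable (fun ω => X 0 ω * X 1 ω) P) (h0 : ∫ ω, X 0 ω * X 1 ω ∂P = 0) :
    ∀ᵐ F ∂μX, F.Centered := by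
  have hp : Measurable fun x : ℝ => ENNReal.ofReal x := by fun_prop
  have hn : Measurable fun x : ℝ => ENNReal.ofReal (-x) := by fun_prop
  have hmp : Measurable fun F : DistFun => ∫⁻ x, ENNReal.ofReal x ∂F.law :=
    (Measure.measurable_lintegral hp).comp DistFun.measurable_law
  have hmn : Measurable fun F : DistFun => ∫⁻ x, ENNReal.ofReal (-x) ∂F.law :=
    (Measure.measurable_lintegral hn).comp DistFun.measurable_law
  have hm0 := hX 0
  have hm1 := hX 1
  have hpos : ∫⁻ ω, ENNReal.ofReal (X 0 ω * X 1 ω) ∂P =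
      ∫⁻ F, (∫⁻ x, ENNReal.ofReal x ∂F.law) * ∫⁻ x, ENNReal.ofReal x ∂F.law ∂μX +
      ∫⁻ F, (∫⁻ x, ENNReal.ofReal (-x) ∂F.law) * ∫⁻ x, ENNReal.ofReal (-x) ∂F.law ∂μX := by
    rw [← h.lintegral_mul hX hp hp, ← h.lintegral_mul hX hn hn,
      ← lintegral_add_left (by fun_prop)]
    simp only [ENNReal.ofReal_mul_eq_add]
  have hneg : ∫⁻ ω, ENNReal.ofReal (-(X 0 ω * X 1 ω)) ∂P =
      2 * ∫⁻ F, (∫⁻ x, ENNReal.ofReal x ∂F.law) * ∫⁻ x, ENNReal.ofReal (-x) ∂F.law ∂μX := by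
    rw [two_mul]
    nth_rw 2 [lintegral_congr fun F : DistFun => mul_comm _ _]
    rw [← h.lintegral_mul hX hp hn, ← h.lintegral_mul hX hn hp,
      ← lintegral_add_left (by fun_prop)]
    simp only [← mul_neg, ENNReal.ofReal_mul_eq_add, neg_neg]
  have hfin := hint.lintegral_lt_top.ne
  rw [hpos, ENNReal.add_ne_top] at hfin
  have heq := ae_eq_of_lintegral_sq_add_lintegral_sq_eq hmp hmn hfin.1 hfin.2
    (by rw [← hpos, ← hneg, lintegral_ofReal_eq_of_integral_eq_zero hint h0])
  filter_upwards [heq, ae_ne_top_of_lintegral_mul_self_ne_top hmp hfin.1,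
    ae_ne_top_of_lintegral_mul_self_ne_top hmn hfin.2] with F hF hFp hFn
  have hFint : Integrable (fun x : ℝ => x) F.law := by
    refine ⟨by fun_prop, ?_⟩
    have habs : ∀ x : ℝ, ‖x‖ₑ = ENNReal.ofReal x + ENNReal.ofReal (-x) := by
      intro x
      rw [Real.enorm_eq_ofReal_abs]
      rcases le_total 0 x with hx | hx
      · rw [abs_of_nonneg hx, ENNReal.ofReal_of_nonpos (neg_nonpos.2 hx), add_zero]
      · rw [abs_of_nonpos hx, ENNReal.ofReal_of_nonpos hx, zero_add]
    rw [HasFiniteIntegral, lintegral_congr habs, lintegral_add_left hp]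
    exact ENNReal.add_lt_top.2 ⟨hFp.lt_top, hFn.lt_top⟩
  refine ⟨hFint, ?_⟩
  rw [integral_eq_lintegral_pos_part_sub_lintegral_neg_part hFint, hF, sub_self]

theorem lintegral_secondMoment (h : IsDirectingMeasure P X μX) (hX : ∀ i, Measurable (X i))
    (hint : Integrable (fun ω => X 0 ω ^ 2) P) :
    ∫⁻ F, F.secondMoment ∂μX = ENNReal.ofReal (∫ ω, X 0 ω ^ 2 ∂P) := by
  rw [ofReal_integral_eq_lintegral_ofReal hint (ae_of_all _ fun ω => sq_nonneg _)]
  exact (h.lintegral_head hX (f := fun x => ENNReal.ofReal (x ^ 2)) (by fun_prop)).symm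

theorem lintegral_secondMoment_mul_self (h : IsDirectingMeasure P X μX)
    (hX : ∀ i, Measurable (X i)) (hint : Integrable (fun ω => X 0 ω ^ 2 * X 1 ω ^ 2) P) :
    ∫⁻ F, F.secondMoment * F.secondMoment ∂μX =
      ENNReal.ofReal (∫ ω, X 0 ω ^ 2 * X 1 ω ^ 2 ∂P) := by
  rw [ofReal_integral_eq_lintegral_ofReal hint (ae_of_all _ fun ω => by positivity)]
  simp only [ENNReal.ofReal_mul (sq_nonneg _)]
  exact (h.lintegral_mul hX (f := fun x => ENNReal.ofReal (x ^ 2))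
    (g := fun x => ENNReal.ofReal (x ^ 2)) (by fun_prop) (by fun_prop)).symm

/-- The covariance of `X 0 ^ 2` and `X 1 ^ 2` is the variance of the second moment under the directing
measure. -/
theorem covariance_eq_zero_iff [IsProbabilityMeasure P] (h : IsDirectingMeasure P X μX)
    (hX : ∀ i, Measurable (X i)) (hident : IdentDistrib (X 1) (X 0) P P)
    (hfour : MemLp (fun ω => X 0 ω ^ 2) 2 P) :
    covariance (fun ω => X 0 ω ^ 2) (fun ω => X 1 ω ^ 2) P = 0 ↔
      ∀ᵐ F ∂μX, F.secondMoment = ENNReal.ofReal (∫ ω, X 0 ω ^ 2 ∂P) := by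
  have := h.isProbabilityMeasure
  have hident2 : IdentDistrib (fun ω => X 1 ω ^ 2) (fun ω => X 0 ω ^ 2) P P := hident.pow
  have hfour1 := hident2.symm.memLp_snd hfour
  have hint : Integrable (fun ω => X 0 ω ^ 2) P := hfour.integrable (by norm_num)
  have hI : 0 ≤ ∫ ω, X 0 ω ^ 2 ∂P := integral_nonneg fun ω => sq_nonneg _
  have hJ : 0 ≤ ∫ ω, X 0 ω ^ 2 * X 1 ω ^ 2 ∂P := integral_nonneg fun ω => by positivity
  have h1 := h.lintegral_secondMoment hX hint
  have h2 := h.lintegral_secondMoment_mul_self hX (hfour.integrable_mul hfour1)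
  rw [covariance_eq_sub hfour hfour1, hident2.integral_eq, sub_eq_zero]
  constructor
  · intro hcov
    refine ae_eq_const_of_lintegral_sq_eq DistFun.measurable_secondMoment ENNReal.ofReal_ne_top h1 ?_
    rw [h2, ← ENNReal.ofReal_mul hI, ← hcov]
    rfl
  · intro hae
    have : ∫⁻ F, F.secondMoment * F.secondMoment ∂μX =
        ∫⁻ F, ENNReal.ofReal (∫ ω, X 0 ω ^ 2 ∂P) * ENNReal.ofReal (∫ ω, X 0 ω ^ 2 ∂P) ∂μX := by
      refine lintegral_congr_ae ?_
      filter_upwards [hae] with F hF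
      rw [hF]
    rw [h2, lintegral_const, measure_univ, mul_one, ← ENNReal.ofReal_mul hI,
      ENNReal.ofReal_eq_ofReal_iff hJ (mul_nonneg hI hI)] at this
    exact this
end IsDirectingMeasure

/-! ### The Gaussian mixture -/

section GaussianMixture
variable {μX : Measure DistFun}

theorem measurable_gaussianReal_secondMoment :
    Measurable fun F : DistFun => gaussianReal 0 F.secondMoment.toNNReal :=
  measurable_gaussianReal.comp
    (measurable_const.prodMk DistFun.measurable_secondMoment.ennreal_toNNReal)

theorem gaussianMixture_eq_bind
    (hμX : ∀ᵐ F ∂μX, F.Centered ∧ F.secondMoment < ∞) :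
    gaussianMixture μX = μX.bind fun F => gaussianReal 0 F.secondMoment.toNNReal := by
  rw [gaussianMixture,
    Measure.restrict_eq_self_of_ae_mem (s := {F : DistFun | F.Centered ∧ F.secondMoment < ∞}) hμX]

theorem norm_charFun_gaussianMixture [IsProbabilityMeasure μX]
    (hμX : ∀ᵐ F ∂μX, F.Centered ∧ F.secondMoment < ∞) (t : ℝ) :
    ‖charFun (gaussianMixture μX) t‖ =
      ∫ F, Real.exp (-(F.secondMoment.toReal * t ^ 2 / 2)) ∂μX := by
  let κ : Kernel DistFun ℝ := ⟨_, measurable_gaussianReal_secondMoment⟩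
  have : IsMarkovKernel κ := ⟨fun F => inferInstanceAs (IsProbabilityMeasure (gaussianReal _ _))⟩
  have hint : Integrable (fun x : ℝ => Complex.exp (t * x * Complex.I)) (κ ∘ₘ μX) := by
    refine Integrable.of_bound (C := 1) (by fun_prop) (ae_of_all _ fun x => ?_)
    rw [← Complex.ofReal_mul, Complex.norm_exp_ofReal_mul_I]
  have hbind : charFun (gaussianMixture μX) t = ∫ F, charFun (κ F) t ∂μX := by
    rw [gaussianMixture_eq_bind hμX]
    change charFun (κ ∘ₘ μX) t = _
    simp only [charFun_apply_real]
    rw [Measure.comp_eq_comp_const_apply] at hint ⊢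
    rw [Kernel.integral_comp hint, Kernel.const_apply]
  have hκ : ∀ F, charFun (κ F) t =
      ((Real.exp (-(F.secondMoment.toReal * t ^ 2 / 2)) : ℝ) : ℂ) := by
    intro F
    change charFun (gaussianReal 0 F.secondMoment.toNNReal) t = _
    rw [charFun_gaussianReal]
    push_cast
    congr 1
    simp [ENNReal.toReal]
  rw [hbind, integral_congr_ae (ae_of_all _ hκ), integral_complex_ofReal, Complex.norm_real,
    Real.norm_of_nonneg (integral_nonneg fun F => (Real.exp_pos _).le)]

/-- The modulus of the characteristic function of the mixture is the Laplace transform of the law of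
`F.secondMoment`. Its values for `t = √2` and `t = 2`, that is, the first two moments of
`exp (-F.secondMoment)`, already show that the latter has no variance. -/
theorem ae_secondMoment_eq_of_gaussianMixture_eq [IsProbabilityMeasure μX]
    (hμX : ∀ᵐ F ∂μX, F.Centered ∧ F.secondMoment < ∞) {m : ℝ} {v : ℝ≥0}
    (h : gaussianMixture μX = gaussianReal m v) : ∀ᵐ F : DistFun ∂μX, F.secondMoment = (v : ℝ≥0∞) := by
  have hnorm : ∀ t : ℝ, ∫ F, Real.exp (-(F.secondMoment.toReal * t ^ 2 / 2)) ∂μX =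
      Real.exp (-(v * t ^ 2 / 2)) := by
    intro t
    rw [← norm_charFun_gaussianMixture hμX t, h, charFun_gaussianReal, Complex.norm_exp]
    congr 1
    simp [← Complex.ofReal_pow]
  have hexp : Measurable fun F : DistFun => ENNReal.ofReal (Real.exp (-F.secondMoment.toReal)) :=
    (Real.measurable_exp.comp DistFun.measurable_secondMoment.ennreal_toReal.neg).ennreal_ofReal
  have hlap : ∀ t : ℝ, ∫⁻ F, ENNReal.ofReal (Real.exp (-(F.secondMoment.toReal * t ^ 2 / 2))) ∂μX =
      ENNReal.ofReal (Real.exp (-(v * t ^ 2 / 2))) := by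
    intro t
    rw [← hnorm, ofReal_integral_eq_lintegral_ofReal _ (ae_of_all _ fun F => (Real.exp_pos _).le)]
    have := DistFun.measurable_secondMoment.ennreal_toReal
    refine Integrable.of_bound (C := 1) (Measurable.aestronglyMeasurable (by fun_prop))
      (ae_of_all _ fun F => ?_)
    rw [Real.norm_of_nonneg (Real.exp_pos _).le, Real.exp_le_one_iff, neg_nonpos]
    positivity
  -- The values `t ^ 2 / 2 = 1` and `t ^ 2 / 2 = 2`.
  have hconst := ae_eq_const_of_lintegral_sq_eq hexp
    (c := ENNReal.ofReal (Real.exp (-v))) ENNReal.ofReal_ne_top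
    (by simpa using hlap √2)
    (by
      simp only [← ENNReal.ofReal_mul (Real.exp_pos _).le, ← Real.exp_add]
      convert hlap 2 using 4 <;> ring_nf)
  filter_upwards [hμX, hconst] with F hF hFv
  rw [ENNReal.ofReal_eq_ofReal_iff (Real.exp_pos _).le (Real.exp_pos _).le, Real.exp_eq_exp,
    neg_inj] at hFv
  rw [← ENNReal.ofReal_toReal hF.2.ne, hFv, ENNReal.ofReal_coe_nnreal]

theorem gaussianMixture_eq_of_ae_secondMoment_eq [IsProbabilityMeasure μX]
    (hμX : ∀ᵐ F ∂μX, F.Centered ∧ F.secondMoment < ∞) {v : ℝ≥0∞}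
    (h : ∀ᵐ F ∂μX, F.secondMoment = v) : gaussianMixture μX = gaussianReal 0 v.toNNReal := by
  rw [gaussianMixture_eq_bind hμX,
    Measure.bind_congr_right (g := fun _ => gaussianReal 0 v.toNNReal) ?_]
  · simp
  · filter_upwards [h] with F hF
    rw [hF]
end GaussianMixture

/-! ### The equivalences -/

theorem corollary3p10 {Ω : Type*} [MeasurableSpace Ω] (P : Measure Ω) [IsProbabilityMeasure P]
    (X : ℕ → Ω → ℝ) (hX : ∀ i, Measurable (X i)) (hexch : Exchangeable P X)
    (hmean : ∫ ω, X 0 ω ∂P = 0) (huncorr : ∫ ω, X 0 ω * X 1 ω ∂P = 0)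
    (hfour : Integrable (fun ω => |X 0 ω| ^ 4) P) :
    (∃ μX : Measure DistFun, IsDirectingMeasure P X μX) ∧
    ∀ μX : Measure DistFun, IsDirectingMeasure P X μX →
      List.TFAE [
        covariance (fun ω => X 0 ω ^ 2) (fun ω => X 1 ω ^ 2) P = 0,
        μX {F | F.Centered ∧ F.secondMoment = ENNReal.ofReal (∫ ω, |X 0 ω| ^ 2 ∂P)} = 1,
        ∃ (m : ℝ) (v : ℝ≥0), gaussianMixture μX = gaussianReal m v] := by
  refine ⟨hexch.exists_isDirectingMeasure hX, fun μX hμX => ?_⟩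
  have := hμX.isProbabilityMeasure
  have hm0 := hX 0
  have hident : IdentDistrib (X 1) (X 0) P P := by
    refine ⟨(hX 1).aemeasurable, (hX 0).aemeasurable, ?_⟩
    have h := congrArg (Measure.map fun x : ℕ → ℝ => x 0)
      (hexch.map_comp_injective hX (σ := Nat.succ) Nat.succ_injective)
    rwa [Measure.map_map (by fun_prop) (by fun_prop),
      Measure.map_map (by fun_prop) (by fun_prop)] at h
  have hsq : MemLp (fun ω => X 0 ω ^ 2) 2 P := by
    rw [memLp_two_iff_integrable_sq (by fun_prop)]
    refine hfour.congr (ae_of_all _ fun ω => ?_)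
    simp only [← pow_mul]
    exact Even.pow_abs (by decide) _
  have hsq_int : Integrable (fun ω => X 0 ω ^ 2) P := hsq.integrable (by norm_num)
  have hmem : MemLp (X 0) 2 P := (memLp_two_iff_integrable_sq (by fun_prop)).2 hsq_int
  have hcent := hμX.ae_centered hX (hmem.integrable_mul (hident.symm.memLp_snd hmem)) huncorr
  have hmoment := hμX.lintegral_secondMoment hX hsq_int
  have hfin : ∀ᵐ F ∂μX, F.Centered ∧ F.secondMoment < ∞ :=
    hcent.and (ae_lt_top DistFun.measurable_secondMoment (hmoment ▸ ENNReal.ofReal_ne_top))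
  have hcov := hμX.covariance_eq_zero_iff hX hident hsq
  simp only [sq_abs]
  tfae_have 1 → 2 := by
    intro h
    rw [← measure_univ (μ := μX)]
    exact measure_congr (eventuallyEq_univ.2 (hcent.and (hcov.1 h)))
  tfae_have 2 → 3 := by
    intro h
    -- Dropping the condition `F.Centered` gives a larger set, whose measurability is immediate.
    have hae : ∀ᵐ F ∂μX, F.secondMoment = ENNReal.ofReal (∫ ω, X 0 ω ^ 2 ∂P) := by
      rw [Filter.Eventually, mem_ae_iff_prob_eq_one
        (measurableSet_eq_fun DistFun.measurable_secondMoment measurable_const)]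
      exact le_antisymm prob_le_one (h.ge.trans (measure_mono fun F hF => hF.2))
    exact ⟨0, _, gaussianMixture_eq_of_ae_secondMoment_eq hfin hae⟩
  tfae_have 3 → 1 := by
    rintro ⟨m, v, h⟩
    have hae := ae_secondMoment_eq_of_gaussianMixture_eq hfin h
    have hv : (v : ℝ≥0∞) = ENNReal.ofReal (∫ ω, X 0 ω ^ 2 ∂P) := by
      rw [← hmoment, lintegral_congr_ae hae]
      simp
    exact hcov.2 (hv ▸ hae)
  tfae_finish
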